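/- Let $\mathbb{T}\subseteq\mathbb{R}$ be an interval (for instance $[0,T]$, $[0,\infty)$ or $(-\infty,\infty)$), let $\Theta\subset\mathbb{R}^d$ be open, convex and bounded, and for each $\vartheta\in\Theta$ let $\lambda(\vartheta,\cdot)\ge 0$ be a locally integrable function on $\mathbb{T}$. Fix a true value $\vartheta_0\in\Theta$ and let $X_1,X_2,\dots$ be independent Poisson processes on $\mathbb{T}$ with intensity function $\lambda(\vartheta_0,\cdot)$; that is, each $X_j=(X_j(t),t\in\mathbb{T})$ is a counting process with independent increments such that $X_j(t_2)-X_j(t_1)$ has the Poisson distribution with mean $\int_{t_1}^{t_2}\lambda(\vartheta_0,s)\,ds$ for all $t_1<t_2$ in $\mathbb{T}$. Let $\mathbf g=(g_1,\dots,g_d):\mathbb{T}\to\mathbb{R}^d$ be a measurable function such that the integrals $$\mathbf M(\vartheta)=\int_{\mathbb{T}}\mathbf g(s)\,\lambda(\vartheta,s)\,ds\quad(\vartheta\in\Theta),\qquad \mathbf G(\vartheta_0)_{lk}=\int_{\mathbb{T}}g_l(s)g_k(s)\lambda(\vartheta_0,s)\,ds\quad(1\le l,k\le d)$$ converge absolutely.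 Suppose that $\mathbf M$ is injective on $\Theta$, with inverse function $\mathbf H$, so that $\mathbf H(\mathbf M(\vartheta))=\vartheta$ for all $\vartheta\in\Theta$, and that 1. for every $\nu>0$ and every $\vartheta'\in\Theta$, $\displaystyle\inf_{\vartheta\in\Theta,\ |\vartheta-\vartheta'|>\nu}|\mathbf M(\vartheta)-\mathbf M(\vartheta')|>0$; 2. $\mathbf H$ is continuously differentiable on an open set containing $\mathbf M(\Theta)$ (outside this set $\mathbf H$ is extended to $\mathbb{R}^d$ by any measurable function). Let $\vartheta_n^*=\mathbf H(\mathbf a_n)$ be the method of moments estimator, where $\mathbf a_n=\frac1n\sum_{j=1}^n\int_{\mathbb{T}}\mathbf g(s)\,dX_j(s)$. Then, as $n\to\infty$, $\vartheta_n^*$ is consistent, i.e. $\vartheta_n^*\to\vartheta_0$ in probability, and asymptotically normal: $$\sqrt n\,(\vartheta_n^*-\vartheta_0)\Longrightarrow\mathcal N\bigl(0,\mathbf D(\vartheta_0)\bigr),\qquad \mathbf D(\vartheta_0)=\mathbf H'(\mathbf M(\vartheta_0))\,\mathbf G(\vartheta_0)\,\mathbf H'(\mathbf M(\vartheta_0))^{T},$$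 where $\mathbf H'(a)=\bigl(\partial H_l(a)/\partial a_k\bigr)_{lk}$ is the Jacobian matrix of $\mathbf H$ at $a$. -/

import Mathlib

open MeasureTheory ProbabilityTheory Filter Topology

/-- Closed bounded intervals of an interval of the real line are compact. -/
instance ordConnected_compactIccSpace (T : Set ℝ) [hT : T.OrdConnected] : CompactIccSpace T where
  isCompact_Icc {a b} := by
    rw [Subtype.isCompact_iff]
    have h : ((↑) : T → ℝ) '' Set.Icc a b = Set.Icc (a : ℝ) (b : ℝ) := by
      ext x
      constructor
      · rintro ⟨y, hy, rfl⟩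
        exact ⟨hy.1, hy.2⟩
      · intro hx
        exact ⟨⟨x, hT.out a.2 b.2 hx⟩, ⟨hx.1, hx.2⟩, rfl⟩
    rw [h]
    exact isCompact_Icc

/-- Path of a counting process on the interval `T`: a nondecreasing right-continuous function
whose increments are nonnegative integers, and which starts from `0` at the left end of `T` if
that end belongs to `T`. (If `T` has no least element, the path is determined by its increments
up to an additive constant, on which the integrals below do not depend.) -/
structure CountingPath (T : Set ℝ) extends StieltjesFunction T where
  exists_nat : ∀ s t : T, s ≤ t → ∃ k : ℕ, toFun t - toFun s = k
  eq_zero : ∀ t : T, IsBot t → toFun t = 0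

/-- The Lebesgue–Stieltjes integral `∫_T g(s) dX(s)` along a counting path. -/
noncomputable def CountingPath.integral {T : Set ℝ} [T.OrdConnected]
    {E : Type*} [NormedAddCommGroup E] [NormedSpace ℝ E]
    (x : CountingPath T) (g : ℝ → E) : E :=
  ∫ s : T, g s ∂x.toStieltjesFunction.measure

/-- An intensity function on `T`: nonnegative, and integrable over compact subintervals. -/
structure IsIntensity (T : Set ℝ) (lam : ℝ → ℝ) : Prop where
  nonneg : ∀ t ∈ T, 0 ≤ lam t
  locallyIntegrableOn : LocallyIntegrableOn lam T

/-- `X` is an inhomogeneous Poisson process on `T` with intensity function `lam`: a counting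
process with independent increments such that `X(t) - X(s)` has the Poisson distribution with
mean `∫_s^t lam(u) du` for all `s ≤ t` in `T`. -/
structure IsPoissonProcess {Ω : Type*} [MeasurableSpace Ω] {T : Set ℝ}
    (X : Ω → CountingPath T) (lam : ℝ → ℝ) (P : Measure Ω) : Prop where
  measurable : ∀ t : T, Measurable fun ω => (X ω).toFun t
  indep_increments : HasIndepIncrements (fun (t : T) ω => (X ω).toFun t) P
  law_increments : ∀ s t : T, s ≤ t →
    HasLaw (fun ω => (X ω).toFun t - (X ω).toFun s)
      ((poissonMeasure (∫ u in (s : ℝ)..t, lam u).toNNReal).map ((↑) : ℕ → ℝ)) P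

section MethodOfMoments

variable {d : ℕ}

/-- `M(ϑ) = ∫_T g(s) λ(ϑ, s) ds`. -/
noncomputable def momentMap (T : Set ℝ) (lam : EuclideanSpace ℝ (Fin d) → ℝ → ℝ)
    (g : ℝ → EuclideanSpace ℝ (Fin d)) (θ : EuclideanSpace ℝ (Fin d)) :
    EuclideanSpace ℝ (Fin d) :=
  ∫ s in T, lam θ s • g s

/-- `G(ϑ)_{lk} = ∫_T g_l(s) g_k(s) λ(ϑ, s) ds`. -/
noncomputable def momentCov (T : Set ℝ) (lam : EuclideanSpace ℝ (Fin d) → ℝ → ℝ)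
    (g : ℝ → EuclideanSpace ℝ (Fin d)) (θ : EuclideanSpace ℝ (Fin d)) :
    Matrix (Fin d) (Fin d) ℝ :=
  Matrix.of fun l k => ∫ s in T, g s l * g s k * lam θ s

/-- The Jacobian matrix `(∂H_l/∂a_k)(a)`. -/
noncomputable def jacobian (H : EuclideanSpace ℝ (Fin d) → EuclideanSpace ℝ (Fin d))
    (a : EuclideanSpace ℝ (Fin d)) : Matrix (Fin d) (Fin d) ℝ :=
  Matrix.of fun l k => fderiv ℝ H a (EuclideanSpace.single k 1) l

/-- `D(ϑ) = H'(M(ϑ)) G(ϑ) H'(M(ϑ))ᵀ`. -/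
noncomputable def limitCov (T : Set ℝ) (lam : EuclideanSpace ℝ (Fin d) → ℝ → ℝ)
    (g : ℝ → EuclideanSpace ℝ (Fin d))
    (H : EuclideanSpace ℝ (Fin d) → EuclideanSpace ℝ (Fin d))
    (θ : EuclideanSpace ℝ (Fin d)) : Matrix (Fin d) (Fin d) ℝ :=
  jacobian H (momentMap T lam g θ) * momentCov T lam g θ *
    (jacobian H (momentMap T lam g θ)).transpose

/-- `a_n = (1/n) ∑_{j<n} ∫_T g dX_j`. -/
noncomputable def empiricalMoment {Ω : Type*} {T : Set ℝ} [T.OrdConnected]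
    (X : ℕ → Ω → CountingPath T) (g : ℝ → EuclideanSpace ℝ (Fin d)) (n : ℕ) (ω : Ω) :
    EuclideanSpace ℝ (Fin d) :=
  (n : ℝ)⁻¹ • ∑ j ∈ Finset.range n, (X j ω).integral g

/-- The method of moments estimator `ϑ*_n = H(a_n)`. -/
noncomputable def momentEstimator {Ω : Type*} {T : Set ℝ} [T.OrdConnected]
    (X : ℕ → Ω → CountingPath T) (g : ℝ → EuclideanSpace ℝ (Fin d))
    (H : EuclideanSpace ℝ (Fin d) → EuclideanSpace ℝ (Fin d)) (n : ℕ) (ω : Ω) :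
    EuclideanSpace ℝ (Fin d) :=
  H (empiricalMoment X g n ω)

/-- The regularity conditions on `M` and on its inverse function `H`. The function `H` is the
inverse of `M` on the set `M(Θ)` of values of `M`, and it is continuously differentiable on an
open set `U` containing `M(Θ)` (which may be `M(Θ)` itself if that set is open). The infimum is
taken in `[0, ∞]`, so that it is `∞` over the empty set. -/
structure RegularityConditions (Θ : Set (EuclideanSpace ℝ (Fin d)))
    (M H : EuclideanSpace ℝ (Fin d) → EuclideanSpace ℝ (Fin d)) : Prop where
  leftInvOn : Set.LeftInvOn H M Θ
  identifiable : ∀ ν : ℝ, 0 < ν → ∀ θ₀ ∈ Θ,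
    0 < ⨅ θ ∈ {θ ∈ Θ | ν < ‖θ - θ₀‖}, ‖M θ - M θ₀‖ₑ
  contDiffOn : ∃ U : Set (EuclideanSpace ℝ (Fin d)), IsOpen U ∧ M '' Θ ⊆ U ∧ ContDiffOn ℝ 1 H U

end MethodOfMoments

/-!
The path integrals `I_j = ∫_T g dX_j` are independent and identically distributed, because each is
the same function of the increments of `X_j`. The random measure `dX` has mean `λ(s) ds`, and
`E[dX(s) dX(t)]` is the product of the means plus `λ(s) ds` carried by the diagonal. Both identities
hold on half-open intervals by the moments of the Poisson law and the independence of increments,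
and extend to all nonnegative integrands because half-open intervals determine a measure, one
variable at a time. Hence `I_j` has mean `M(ϑ₀)` and covariance matrix `G(ϑ₀)`. The law of large
numbers and the central limit theorem apply to the averages `a_n`, and the delta method carries
both through `H`, which is differentiable at `M(ϑ₀)`.
-/

section HalfOpenIntervals

variable {α : Type*} [LinearOrder α] [TopologicalSpace α] [OrderTopology α]

lemma measureReal_Ioc_inter_eq_sub [MeasurableSpace α] [OpensMeasurableSpace α] {μ : Measure α}
    {r s t : α} (hrs : r ≤ s) (hst : s ≤ t) {A : Set α} (hA : MeasurableSet A)
    (hfin : μ (Set.Ioc r t) ≠ ⊤) :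
    μ.real (Set.Ioc s t ∩ A) = μ.real (Set.Ioc r t ∩ A) - μ.real (Set.Ioc r s ∩ A) := by
  have hunion : Set.Ioc r t ∩ A = Set.Ioc r s ∩ A ∪ Set.Ioc s t ∩ A := by
    rw [← Set.union_inter_distrib_right, Set.Ioc_union_Ioc_eq_Ioc hrs hst]
  have hle {S : Set α} (hS : S ⊆ Set.Ioc r t) : μ (S ∩ A) ≠ ⊤ :=
    measure_ne_top_of_subset (Set.inter_subset_left.trans hS) hfin
  rw [hunion, measureReal_union ((Set.Ioc_disjoint_Ioc_of_le le_rfl).mono Set.inter_subset_left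
    Set.inter_subset_left) (measurableSet_Ioc.inter hA) (hle (Set.Ioc_subset_Ioc_right hst))
    (hle (Set.Ioc_subset_Ioc_left hrs)), add_sub_cancel_left]

variable [SecondCountableTopology α]

variable (α) in
lemma exists_monotone_Ioc_exhaustion [Nonempty α] :
    ∃ u v : ℕ → α, Monotone (fun n => Set.Ioc (u n) (v n)) ∧
      (⋃ n, Set.Ioc (u n) (v n))ᶜ ⊆ botSet := by
  obtain ⟨u, hu, hu'⟩ := exists_seq_antitone_tendsto_atTop_atBot α
  obtain ⟨v, hv, hv'⟩ := exists_seq_monotone_tendsto_atTop_atTop α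
  refine ⟨u, v, fun m n h => Set.Ioc_subset_Ioc (hu h) (hv h), fun x hx => ?_⟩
  by_contra hbot
  obtain ⟨y, hy⟩ : ∃ y, y < x := by simpa [botSet, IsBot] using hbot
  obtain ⟨n, hun, hvn⟩ :=
    ((hu'.eventually (eventually_le_atBot y)).and (hv'.eventually (eventually_ge_atTop x))).exists
  exact hx (Set.mem_iUnion.2 ⟨n, hun.trans_lt hy, hvn⟩)

variable [MeasurableSpace α] [BorelSpace α]

lemma measure_ext_of_Ioc_of_botSet {μ ν : Measure α} (hμ : μ botSet = 0) (hν : ν botSet = 0)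
    (hfin : ∀ a b, μ (Set.Ioc a b) ≠ ⊤)
    (h : ∀ a b, a ≤ b → μ (Set.Ioc a b) = ν (Set.Ioc a b)) : μ = ν := by
  rcases isEmpty_or_nonempty α with hα | hα
  · exact Subsingleton.elim _ _
  obtain ⟨u, v, -, huv⟩ := exists_monotone_Ioc_exhaustion α
  have hcover : ⋃ n : Option ℕ, (n.elim botSet fun n => Set.Ioc (u n) (v n)) = Set.univ := by
    refine Set.eq_univ_of_forall fun x => ?_
    by_cases hx : x ∈ ⋃ n, Set.Ioc (u n) (v n)
    · obtain ⟨n, hn⟩ := Set.mem_iUnion.1 hx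
      exact Set.mem_iUnion.2 ⟨some n, hn⟩
    · exact Set.mem_iUnion.2 ⟨none, huv hx⟩
  rw [Measure.ext_iff_of_iUnion_eq_univ hcover]
  rintro (_ | n)
  · simp [Measure.restrict_eq_zero.2 hμ, Measure.restrict_eq_zero.2 hν]
  · have : IsFiniteMeasure (μ.restrict (Set.Ioc (u n) (v n))) :=
      ⟨by simpa using (hfin (u n) (v n)).lt_top⟩
    refine Measure.ext_of_Iic (μ.restrict (Set.Ioc (u n) (v n)))
      (ν.restrict (Set.Ioc (u n) (v n))) fun a => ?_
    simp only [Measure.restrict_apply measurableSet_Iic, Set.inter_comm (Set.Iic a),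
      Set.Ioc_inter_Iic]
    rcases le_total (u n) (v n ⊓ a) with hle | hle
    · exact h _ _ hle
    · simp [Set.Ioc_eq_empty hle.not_gt]

lemma measurable_measure_of_Ioc {Ω : Type*} [MeasurableSpace Ω] {μ : Ω → Measure α}
    (hbot : ∀ ω, μ ω botSet = 0) (hfin : ∀ ω a b, μ ω (Set.Ioc a b) ≠ ⊤)
    (h : ∀ a b, Measurable fun ω => μ ω (Set.Ioc a b)) : Measurable μ := by
  rcases isEmpty_or_nonempty α with hα | hα
  · rw [show μ = fun _ => 0 from funext fun _ => Subsingleton.elim _ _]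
    exact measurable_const
  obtain ⟨u, v, hmono, huv⟩ := exists_monotone_Ioc_exhaustion α
  have hrestr (n : ℕ) : Measurable fun ω => (μ ω).restrict (Set.Ioc (u n) (v n)) := by
    have hf (ω : Ω) : IsFiniteMeasure ((μ ω).restrict (Set.Ioc (u n) (v n))) :=
      ⟨by simpa using (hfin ω (u n) (v n)).lt_top⟩
    refine Measurable.measure_of_isPiSystem
      (BorelSpace.measurable_eq.trans (borel_eq_generateFrom_Iic α)) isPiSystem_Iic ?_ ?_
    · rintro _ ⟨a, rfl⟩
      simp_rw [Measure.restrict_apply measurableSet_Iic, Set.inter_comm (Set.Iic a),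
        Set.Ioc_inter_Iic]
      exact h _ _
    · simpa using h _ _
  refine Measure.measurable_of_measurable_coe _ fun s hs => ?_
  have hsup (ω : Ω) : μ ω s = ⨆ n, (μ ω).restrict (Set.Ioc (u n) (v n)) s := by
    simp_rw [Measure.restrict_apply hs]
    rw [← Monotone.measure_iUnion fun m n hmn => Set.inter_subset_inter_right s (hmono hmn),
      ← Set.inter_iUnion]
    exact (measure_inter_conull (measure_mono_null huv (hbot ω))).symm
  simp_rw [hsup]
  exact .iSup fun n => (Measure.measurable_coe hs).comp (hrestr n)

lemma lintegral_mul_lintegral_eq_of_Ioc_of_botSet {Ω : Type*} [MeasurableSpace Ω] {P : Measure Ω}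
    {N : Ω → Measure α} (hN : Measurable N) (hbot : ∀ ω, N ω botSet = 0) {W : Ω → ENNReal}
    (hW : Measurable W) {ν : Measure α} (hν : ν botSet = 0) (hfin : ∀ a b, ν (Set.Ioc a b) ≠ ⊤)
    (h : ∀ a b, a ≤ b → ∫⁻ ω, W ω * N ω (Set.Ioc a b) ∂P = ν (Set.Ioc a b))
    {f : α → ENNReal} (hf : Measurable f) :
    ∫⁻ ω, W ω * ∫⁻ s, f s ∂(N ω) ∂P = ∫⁻ s, f s ∂ν := by
  have hIoc (a b : α) : Measurable fun ω => N ω (Set.Ioc a b) :=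
    (Measure.measurable_coe measurableSet_Ioc).comp hN
  have hlint : Measurable fun ω => ∫⁻ s, f s ∂(N ω) := (Measure.measurable_lintegral hf).comp hN
  have hbind : ν = (P.withDensity W).bind N := by
    refine measure_ext_of_Ioc_of_botSet hν ?_ hfin fun a b hab => ?_
    · rw [Measure.bind_apply measurableSet_botSet hN.aemeasurable]
      simp [hbot]
    · rw [Measure.bind_apply measurableSet_Ioc hN.aemeasurable,
        lintegral_withDensity_eq_lintegral_mul _ hW (hIoc a b)]
      exact (h a b hab).symm
  rw [hbind, Measure.lintegral_bind hN.aemeasurable hf.aemeasurable,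
    lintegral_withDensity_eq_lintegral_mul _ hW hlint]
  rfl

end HalfOpenIntervals

section IndependentIncrements

lemma exists_monotone_nat_subset_range {α : Type*} [LinearOrder α] [Nonempty α] (s : Finset α) :
    ∃ τ : ℕ → α, Monotone τ ∧ (s : Set α) ⊆ Set.range τ := by
  rcases s.eq_empty_or_nonempty with rfl | hs
  · exact ⟨fun _ => Classical.arbitrary α, monotone_const, by simp⟩
  have hcard : 0 < s.card := hs.card_pos
  refine ⟨fun n => s.orderEmbOfFin rfl ⟨min n (s.card - 1), by omega⟩, fun m n h => ?_,
    fun x hx => ?_⟩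
  · refine (s.orderEmbOfFin rfl).monotone ?_
    simp only [Fin.mk_le_mk]
    omega
  · obtain ⟨i, rfl⟩ : x ∈ Set.range (s.orderEmbOfFin rfl) := by simpa using hx
    exact ⟨i, congrArg (s.orderEmbOfFin rfl) (Fin.ext (min_eq_left (Nat.le_sub_one_of_lt i.2)))⟩

lemma map_increments_eq_of_hasIndepIncrements {T Ω E : Type*} [LinearOrder T]
    [MeasurableSpace Ω] [AddCommGroup E] [MeasurableSpace E] [MeasurableAdd₂ E]
    [MeasurableSub₂ E] {P : Measure Ω} [IsProbabilityMeasure P] {X Y : T → Ω → E}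
    (hX : ∀ t, Measurable (X t)) (hY : ∀ t, Measurable (Y t))
    (hXi : HasIndepIncrements X P) (hYi : HasIndepIncrements Y P)
    (h : ∀ s t, s ≤ t →
      P.map (fun ω => X t ω - X s ω) = P.map (fun ω => Y t ω - Y s ω)) :
    P.map (fun ω (p : T × T) => X p.2 ω - X p.1 ω) =
      P.map (fun ω (p : T × T) => Y p.2 ω - Y p.1 ω) := by
  rcases isEmpty_or_nonempty T with hT | hT
  · exact congrArg P.map (Subsingleton.elim _ _)
  have mX : Measurable fun ω (p : T × T) => X p.2 ω - X p.1 ω := by fun_prop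
  have mY : Measurable fun ω (p : T × T) => Y p.2 ω - Y p.1 ω := by fun_prop
  refine (map_eq_iff_forall_finset_map_restrict_eq (X := fun (p : T × T) ω => X p.2 ω - X p.1 ω)
    (Y := fun p ω => Y p.2 ω - Y p.1 ω) mX.aemeasurable mY.aemeasurable).2 fun I => ?_
  obtain ⟨τ, hτ, hrange⟩ :=
    exists_monotone_nat_subset_range (I.image Prod.fst ∪ I.image Prod.snd)
  choose i hi using fun p : I => hrange
    (Finset.mem_union_left _ (Finset.mem_image_of_mem Prod.fst p.2))
  choose j hj using fun p : I => hrange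
    (Finset.mem_union_right _ (Finset.mem_image_of_mem Prod.snd p.2))
  let ψ : (ℕ → E) → I → E := fun x p =>
    ∑ k ∈ Finset.range (j p), x k - ∑ k ∈ Finset.range (i p), x k
  have hψ : Measurable ψ := by fun_prop
  have hmap (Z : T → Ω → E) (hZ : ∀ t, Measurable (Z t)) :
      P.map (fun ω => I.restrict fun p => Z p.2 ω - Z p.1 ω) =
        (P.map fun ω k => Z (τ (k + 1)) ω - Z (τ k) ω).map ψ := by
    rw [Measure.map_map hψ (by fun_prop)]
    congr 1
    ext ω p
    simp only [Function.comp_apply, ψ, Finset.restrict]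
    rw [Finset.sum_range_sub (fun k => Z (τ k) ω), Finset.sum_range_sub (fun k => Z (τ k) ω),
      hi p, hj p, sub_sub_sub_cancel_right]
  rw [hmap X hX, hmap Y hY,
    (iIndepFun_iff_map_fun_eq_infinitePi_map (by fun_prop)).1 (hXi.nat hτ),
    (iIndepFun_iff_map_fun_eq_infinitePi_map (by fun_prop)).1 (hYi.nat hτ)]
  congr 2 with k : 1
  exact h _ _ (hτ k.le_succ)

end IndependentIncrements

section PathIntegral

variable {T : Set ℝ} [T.OrdConnected] {Ω : Type*} [MeasurableSpace Ω] {P : Measure Ω}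
  {E : Type*} [NormedAddCommGroup E] [NormedSpace ℝ E] {g : ℝ → E} {lam : ℝ → ℝ}

lemma CountingPath.measurable_measure {X : Ω → CountingPath T}
    (hX : ∀ s t, Measurable fun ω => (X ω).toFun t - (X ω).toFun s) :
    Measurable fun ω => (X ω).toStieltjesFunction.measure := by
  refine measurable_measure_of_Ioc (fun ω => StieltjesFunction.measure_botSet _)
    (fun ω a b => by simp) fun a b => ?_
  simp only [StieltjesFunction.measure_Ioc]
  exact (hX a b).ennreal_ofReal

lemma CountingPath.stronglyMeasurable_integral {X : Ω → CountingPath T}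
    (hX : ∀ s t, Measurable fun ω => (X ω).toFun t - (X ω).toFun s) (hg : StronglyMeasurable g) :
    StronglyMeasurable fun ω => (X ω).integral g :=
  (hg.comp_measurable measurable_subtype_coe).integral_kernel
    (κ := ⟨_, CountingPath.measurable_measure hX⟩)

lemma CountingPath.exists_stronglyMeasurable_integral_eq [CompleteSpace E]
    (hg : StronglyMeasurable g) :
    ∃ φ : (T × T → ℝ) → E, StronglyMeasurable φ ∧
      ∀ x : CountingPath T, x.integral g = φ fun p => x.toFun p.2 - x.toFun p.1 := by
  let inc : CountingPath T → T × T → ℝ := fun x p => x.toFun p.2 - x.toFun p.1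
  let _ : MeasurableSpace (CountingPath T) := MeasurableSpace.comap inc inferInstance
  have hint : StronglyMeasurable fun x : CountingPath T => x.integral g :=
    CountingPath.stronglyMeasurable_integral (X := id)
      (fun s t => (measurable_pi_apply (s, t)).comp (comap_measurable inc)) hg
  obtain ⟨φ, hφ, h⟩ := hint.exists_eq_measurable_comp
  exact ⟨φ, hφ, congrFun h⟩

lemma IsPoissonProcess.measurable_measure {X : Ω → CountingPath T}
    (hX : IsPoissonProcess X lam P) : Measurable fun ω => (X ω).toStieltjesFunction.measure :=
  CountingPath.measurable_measure fun s t => (hX.measurable t).sub (hX.measurable s)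

variable [CompleteSpace E] [MeasurableSpace E] [BorelSpace E]

lemma IsPoissonProcess.identDistrib_integral [IsProbabilityMeasure P] {X Y : Ω → CountingPath T}
    (hX : IsPoissonProcess X lam P) (hY : IsPoissonProcess Y lam P)
    (hg : StronglyMeasurable g) :
    IdentDistrib (fun ω => (X ω).integral g) (fun ω => (Y ω).integral g) P P := by
  have hmeas {Z : Ω → CountingPath T} (hZ : IsPoissonProcess Z lam P) :
      Measurable fun ω (p : T × T) => (Z ω).toFun p.2 - (Z ω).toFun p.1 :=
    measurable_pi_lambda _ fun p => (hZ.measurable p.2).sub (hZ.measurable p.1)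
  have hlaw : IdentDistrib (fun ω (p : T × T) => (X ω).toFun p.2 - (X ω).toFun p.1)
      (fun ω (p : T × T) => (Y ω).toFun p.2 - (Y ω).toFun p.1) P P :=
    ⟨(hmeas hX).aemeasurable, (hmeas hY).aemeasurable,
      map_increments_eq_of_hasIndepIncrements hX.measurable hY.measurable
        hX.indep_increments hY.indep_increments fun s t hst =>
          (hX.law_increments s t hst).map_eq.trans (hY.law_increments s t hst).map_eq.symm⟩
  obtain ⟨φ, hφ, h⟩ := CountingPath.exists_stronglyMeasurable_integral_eq (T := T) hg
  simp_rw [h]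
  exact hlaw.comp hφ.measurable

lemma iIndepFun_countingPath_integral {ι : Type*} {X : ι → Ω → CountingPath T}
    (hg : StronglyMeasurable g) (hindep : iIndepFun (fun j ω (t : T) => (X j ω).toFun t) P) :
    iIndepFun (fun j ω => (X j ω).integral g) P := by
  obtain ⟨φ, hφ, h⟩ := CountingPath.exists_stronglyMeasurable_integral_eq (T := T) hg
  simp_rw [h]
  exact hindep.comp (fun _ (x : T → ℝ) => φ fun p => x p.2 - x p.1) fun _ =>
    hφ.measurable.comp (by fun_prop)

end PathIntegral

section Poisson

open scoped NNReal Nat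

-- The size-bias identity `E[N f(N - 1)] = r E[f(N)]` of a Poisson variable `N` with mean `r`.
lemma hasSum_poisson_mul_nat (r : ℝ≥0) {f : ℕ → ℝ} {c : ℝ}
    (h : HasSum (fun n => Real.exp (-r) * r ^ n / n ! * f n) c) :
    HasSum (fun n => Real.exp (-r) * r ^ n / n ! * (n * f (n - 1))) (r * c) := by
  rw [← hasSum_nat_add_iff' 1]
  simp only [Finset.range_one, Finset.sum_singleton, Nat.cast_zero, zero_mul, mul_zero, sub_zero,
    Nat.add_sub_cancel]
  convert! h.mul_left (r : ℝ) using 2 with n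
  rw [Nat.factorial_succ]
  push_cast
  have : (n ! : ℝ) ≠ 0 := by positivity
  field_simp
  ring

lemma hasSum_poisson_id (r : ℝ≥0) :
    HasSum (fun n : ℕ => Real.exp (-r) * r ^ n / n ! * n) r := by
  simpa using hasSum_poisson_mul_nat r (f := fun _ => 1) (c := 1)
    (by simpa using hasSum_one_poissonMeasure r)

lemma hasSum_poisson_sq (r : ℝ≥0) :
    HasSum (fun n : ℕ => Real.exp (-r) * r ^ n / n ! * (n : ℝ) ^ 2) (r + r ^ 2) := by
  have h := hasSum_poisson_mul_nat r (f := fun n => n + 1) (c := r + 1)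
    (by simpa [mul_add] using (hasSum_poisson_id r).add (hasSum_one_poissonMeasure r))
  convert! h using 1
  · ext (_ | n) <;> simp [sq]
  · ring

lemma memLp_two_id_poisson (r : ℝ≥0) :
    MemLp id 2 ((poissonMeasure r).map ((↑) : ℕ → ℝ)) := by
  rw [memLp_two_iff_integrable_sq (by fun_prop),
    integrable_map_measure (by fun_prop) .of_discrete, integrable_poissonMeasure_iff]
  simpa using (hasSum_poisson_sq r).summable

lemma integral_id_poisson (r : ℝ≥0) :
    ∫ x, x ∂((poissonMeasure r).map ((↑) : ℕ → ℝ)) = r := by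
  rw [integral_map .of_discrete (by fun_prop), integral_poissonMeasure]
  simpa using (hasSum_poisson_id r).tsum_eq

lemma integral_sq_poisson (r : ℝ≥0) :
    ∫ x, x ^ 2 ∂((poissonMeasure r).map ((↑) : ℕ → ℝ)) = r + r ^ 2 := by
  rw [integral_map .of_discrete (by fun_prop), integral_poissonMeasure]
  simpa using (hasSum_poisson_sq r).tsum_eq

lemma variance_id_poisson (r : ℝ≥0) :
    Var[id; (poissonMeasure r).map ((↑) : ℕ → ℝ)] = r := by
  have : IsProbabilityMeasure ((poissonMeasure r).map ((↑) : ℕ → ℝ)) :=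
    Measure.isProbabilityMeasure_map .of_discrete
  rw [variance_eq_sub (memLp_two_id_poisson r)]
  simp [integral_sq_poisson, integral_id_poisson]

end Poisson

section Intensity

variable {T : Set ℝ} {lam : ℝ → ℝ}

/-- The intensity measure `lam(s) ds` of a Poisson process on `T`: the mean of its random counting
measure. It lives on the subtype `T`, like the Stieltjes measures of the paths. -/
noncomputable def intensityMeasure (T : Set ℝ) (lam : ℝ → ℝ) : Measure T :=
  ((volume.restrict T).withDensity fun s => ENNReal.ofReal (lam s)).comap (↑)

lemma IsIntensity.aemeasurable_ofReal (h : IsIntensity T lam) :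
    AEMeasurable (fun s => ENNReal.ofReal (lam s)) (volume.restrict T) :=
  h.locallyIntegrableOn.aestronglyMeasurable.aemeasurable.ennreal_ofReal

variable [hT : T.OrdConnected]

lemma intensityMeasure_botSet : intensityMeasure T lam botSet = 0 := by
  rw [intensityMeasure, (MeasurableEmbedding.subtype_coe hT.measurableSet).comap_apply]
  exact ((withDensity_absolutelyContinuous _ _).trans Measure.restrict_le_self.absolutelyContinuous)
    ((subsingleton_botSet.image _).measure_zero _)

lemma IsIntensity.integrableOn_Ioc (h : IsIntensity T lam) (s t : T) :
    IntegrableOn lam (Set.Ioc (s : ℝ) t) :=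
  (h.locallyIntegrableOn.integrableOn_compact_subset (hT.out s.2 t.2) isCompact_Icc).mono_set
    Set.Ioc_subset_Icc_self

lemma IsIntensity.intensityMeasure_Ioc (h : IsIntensity T lam) {s t : T} (hst : s ≤ t) :
    intensityMeasure T lam (Set.Ioc s t) = ENNReal.ofReal (∫ u in (s : ℝ)..t, lam u) := by
  have hsub : Set.Ioc (s : ℝ) t ⊆ T := Set.Ioc_subset_Icc_self.trans (hT.out s.2 t.2)
  have himage : ((↑) : T → ℝ) '' Set.Ioc s t = Set.Ioc (s : ℝ) t := by
    ext x
    exact ⟨fun ⟨_, hy, hyx⟩ => hyx ▸ hy, fun hx => ⟨⟨x, hsub hx⟩, hx, rfl⟩⟩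
  rw [intensityMeasure, (MeasurableEmbedding.subtype_coe hT.measurableSet).comap_apply, himage,
    withDensity_apply _ measurableSet_Ioc, Measure.restrict_restrict measurableSet_Ioc,
    Set.inter_eq_left.2 hsub, intervalIntegral.integral_of_le hst,
    ofReal_integral_eq_lintegral_ofReal (h.integrableOn_Ioc s t)]
  exact (ae_restrict_iff' measurableSet_Ioc).2 (ae_of_all _ fun x hx => h.nonneg x (hsub hx))

lemma IsIntensity.intensityMeasure_Ioc_ne_top (h : IsIntensity T lam) (s t : T) :
    intensityMeasure T lam (Set.Ioc s t) ≠ ⊤ := by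
  rcases le_total s t with hst | hst
  · rw [h.intensityMeasure_Ioc hst]
    exact ENNReal.ofReal_ne_top
  · simp [Set.Ioc_eq_empty hst.not_gt]

lemma IsIntensity.integral_intensityMeasure {E : Type*} [NormedAddCommGroup E] [NormedSpace ℝ E]
    (h : IsIntensity T lam) (f : ℝ → E) :
    ∫ s : T, f s ∂(intensityMeasure T lam) = ∫ s in T, lam s • f s := by
  rw [intensityMeasure, integral_subtype_comap hT.measurableSet,
    restrict_withDensity hT.measurableSet, Measure.restrict_restrict hT.measurableSet,
    Set.inter_self,
    integral_withDensity_eq_integral_toReal_smul₀ h.aemeasurable_ofReal (by simp)]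
  refine setIntegral_congr_fun hT.measurableSet fun s hs => ?_
  simp [ENNReal.toReal_ofReal (h.nonneg s hs)]

lemma IsIntensity.integrable_intensityMeasure_iff {E : Type*} [NormedAddCommGroup E]
    [NormedSpace ℝ E] (h : IsIntensity T lam) (f : ℝ → E) :
    Integrable (fun s : T => f s) (intensityMeasure T lam) ↔
      IntegrableOn (fun s => lam s • f s) T := by
  rw [intensityMeasure, ← Function.comp_def f,
    ← (MeasurableEmbedding.subtype_coe hT.measurableSet).integrable_map_iff,
    map_comap_subtype_coe hT.measurableSet, restrict_withDensity hT.measurableSet,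
    Measure.restrict_restrict hT.measurableSet, Set.inter_self,
    integrable_withDensity_iff_integrable_smul₀' h.aemeasurable_ofReal (by simp), ← IntegrableOn]
  refine integrableOn_congr_fun (fun s hs => ?_) hT.measurableSet
  simp [ENNReal.toReal_ofReal (h.nonneg s hs)]

end Intensity

section Increments

variable {T : Set ℝ} {Ω : Type*} [MeasurableSpace Ω] {P : Measure Ω}
  {lam : ℝ → ℝ} {X : Ω → CountingPath T}

lemma IsPoissonProcess.memLp_increment (hX : IsPoissonProcess X lam P) {s t : T} (hst : s ≤ t) :
    MemLp (fun ω => (X ω).toFun t - (X ω).toFun s) 2 P := by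
  have h := hX.law_increments s t hst
  have hid := memLp_two_id_poisson (∫ u in (s : ℝ)..t, lam u).toNNReal
  rw [← h.map_eq] at hid
  exact (memLp_map_measure_iff (by fun_prop) h.aemeasurable).1 hid

variable [T.OrdConnected]

lemma IsPoissonProcess.integral_increment (hX : IsPoissonProcess X lam P)
    (hlam : IsIntensity T lam) {s t : T} (hst : s ≤ t) :
    ∫ ω, ((X ω).toFun t - (X ω).toFun s) ∂P = (intensityMeasure T lam).real (Set.Ioc s t) := by
  rw [(hX.law_increments s t hst).integral_eq, integral_id_poisson, measureReal_def,
    hlam.intensityMeasure_Ioc hst]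
  rfl

lemma IsPoissonProcess.variance_increment (hX : IsPoissonProcess X lam P)
    (hlam : IsIntensity T lam) {s t : T} (hst : s ≤ t) :
    Var[fun ω => (X ω).toFun t - (X ω).toFun s; P] =
      (intensityMeasure T lam).real (Set.Ioc s t) := by
  rw [(hX.law_increments s t hst).variance_eq, variance_id_poisson, measureReal_def,
    hlam.intensityMeasure_Ioc hst]
  rfl

variable [IsProbabilityMeasure P]

lemma IsPoissonProcess.covariance_increment_of_le (hX : IsPoissonProcess X lam P)
    (hlam : IsIntensity T lam) {r s t : T} (hrs : r ≤ s) (hst : s ≤ t) :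
    cov[fun ω => (X ω).toFun s - (X ω).toFun r, fun ω => (X ω).toFun t - (X ω).toFun r; P] =
      (intensityMeasure T lam).real (Set.Ioc r s) := by
  have hrsL := hX.memLp_increment hrs
  have hstL := hX.memLp_increment hst
  have hind : cov[fun ω => (X ω).toFun s - (X ω).toFun r,
      fun ω => (X ω).toFun t - (X ω).toFun s; P] = 0 :=
    (hX.indep_increments.indepFun_sub_sub hrs hst).covariance_eq_zero hrsL hstL
  have hsplit : (fun ω => (X ω).toFun t - (X ω).toFun r) =
      (fun ω => (X ω).toFun s - (X ω).toFun r) + fun ω => (X ω).toFun t - (X ω).toFun s := by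
    ext ω
    simp
  rw [hsplit, covariance_add_right hrsL hrsL hstL, hind, add_zero,
    covariance_self hrsL.aestronglyMeasurable.aemeasurable, hX.variance_increment hlam hrs]

lemma IsPoissonProcess.covariance_increment_left (hX : IsPoissonProcess X lam P)
    (hlam : IsIntensity T lam) {r s t : T} (hrs : r ≤ s) (hrt : r ≤ t) :
    cov[fun ω => (X ω).toFun s - (X ω).toFun r, fun ω => (X ω).toFun t - (X ω).toFun r; P] =
      (intensityMeasure T lam).real (Set.Ioc r s ∩ Set.Ioc r t) := by
  rw [Set.Ioc_inter_Ioc, sup_idem]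
  rcases le_total s t with hst | hts
  · rw [inf_eq_left.2 hst, hX.covariance_increment_of_le hlam hrs hst]
  · rw [inf_eq_right.2 hts, covariance_comm, hX.covariance_increment_of_le hlam hrt hts]

lemma IsPoissonProcess.covariance_increment (hX : IsPoissonProcess X lam P)
    (hlam : IsIntensity T lam) {a b c d : T} (hab : a ≤ b) (hcd : c ≤ d) :
    cov[fun ω => (X ω).toFun b - (X ω).toFun a, fun ω => (X ω).toFun d - (X ω).toFun c; P] =
      (intensityMeasure T lam).real (Set.Ioc a b ∩ Set.Ioc c d) := by
  obtain ⟨r, hra, hrc⟩ : ∃ r : T, r ≤ a ∧ r ≤ c := ⟨a ⊓ c, inf_le_left, inf_le_right⟩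
  have hrb := hra.trans hab
  have hrd := hrc.trans hcd
  have hsub {s t : T} : (fun ω => (X ω).toFun t - (X ω).toFun s) =
      (fun ω => (X ω).toFun t - (X ω).toFun r) - fun ω => (X ω).toFun s - (X ω).toFun r := by
    ext ω
    simp
  have hdiff {s t : T} (hrs : r ≤ s) (hst : s ≤ t) {A : Set T} (hA : MeasurableSet A) :=
    measureReal_Ioc_inter_eq_sub hrs hst hA (hlam.intensityMeasure_Ioc_ne_top r t)
  have hL {t : T} (hrt : r ≤ t) := hX.memLp_increment hrt
  rw [hsub (s := a), hsub (s := c), covariance_sub_left (hL hrb) (hL hra) ((hL hrd).sub (hL hrc)),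
    covariance_sub_right (hL hrb) (hL hrd) (hL hrc),
    covariance_sub_right (hL hra) (hL hrd) (hL hrc), hX.covariance_increment_left hlam hrb hrd,
    hX.covariance_increment_left hlam hrb hrc, hX.covariance_increment_left hlam hra hrd,
    hX.covariance_increment_left hlam hra hrc, hdiff hra hab measurableSet_Ioc,
    Set.inter_comm _ (Set.Ioc c d), hdiff hrc hcd measurableSet_Ioc,
    Set.inter_comm _ (Set.Ioc c d), hdiff hrc hcd measurableSet_Ioc]
  simp only [Set.inter_comm]

lemma IsPoissonProcess.lintegral_measure_Ioc (hX : IsPoissonProcess X lam P)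
    (hlam : IsIntensity T lam) {a b : T} (hab : a ≤ b) :
    ∫⁻ ω, (X ω).toStieltjesFunction.measure (Set.Ioc a b) ∂P =
      intensityMeasure T lam (Set.Ioc a b) := by
  simp_rw [StieltjesFunction.measure_Ioc]
  rw [← ofReal_integral_eq_lintegral_ofReal ((hX.memLp_increment hab).integrable one_le_two)
      (ae_of_all _ fun ω => sub_nonneg.2 ((X ω).mono hab)), hX.integral_increment hlam hab,
    ofReal_measureReal (hlam.intensityMeasure_Ioc_ne_top a b)]

lemma IsPoissonProcess.lintegral_measure_Ioc_mul (hX : IsPoissonProcess X lam P)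
    (hlam : IsIntensity T lam) {a b c d : T} (hab : a ≤ b) (hcd : c ≤ d) :
    ∫⁻ ω, (X ω).toStieltjesFunction.measure (Set.Ioc a b) *
        (X ω).toStieltjesFunction.measure (Set.Ioc c d) ∂P =
      intensityMeasure T lam (Set.Ioc a b) * intensityMeasure T lam (Set.Ioc c d) +
        intensityMeasure T lam (Set.Ioc a b ∩ Set.Ioc c d) := by
  have hfin := hlam.intensityMeasure_Ioc_ne_top
  have habL := hX.memLp_increment hab
  have hcdL := hX.memLp_increment hcd
  have hint : Integrable
      (fun ω => ((X ω).toFun b - (X ω).toFun a) * ((X ω).toFun d - (X ω).toFun c)) P :=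
    habL.integrable_mul hcdL
  have hprod : ∫ ω, ((X ω).toFun b - (X ω).toFun a) * ((X ω).toFun d - (X ω).toFun c) ∂P =
      (intensityMeasure T lam).real (Set.Ioc a b) * (intensityMeasure T lam).real (Set.Ioc c d) +
        (intensityMeasure T lam).real (Set.Ioc a b ∩ Set.Ioc c d) := by
    rw [← hX.integral_increment hlam hab, ← hX.integral_increment hlam hcd,
      ← hX.covariance_increment hlam hab hcd, covariance_eq_sub habL hcdL, add_sub_cancel]
    rfl
  simp_rw [StieltjesFunction.measure_Ioc, ← ENNReal.ofReal_mul (sub_nonneg.2 ((X _).mono hab))]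
  rw [← ofReal_integral_eq_lintegral_ofReal hint (ae_of_all _ fun ω =>
      mul_nonneg (sub_nonneg.2 ((X ω).mono hab)) (sub_nonneg.2 ((X ω).mono hcd))), hprod,
    ENNReal.ofReal_add (by positivity) (by positivity), ENNReal.ofReal_mul (by positivity),
    ofReal_measureReal (hfin a b), ofReal_measureReal (hfin c d),
    ofReal_measureReal (measure_ne_top_of_subset Set.inter_subset_left (hfin a b))]

end Increments

section Campbell

variable {T : Set ℝ} [T.OrdConnected] {Ω : Type*} [MeasurableSpace Ω] {P : Measure Ω}
  {lam : ℝ → ℝ} {X : Ω → CountingPath T}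

lemma IsPoissonProcess.measurable_lintegral (hX : IsPoissonProcess X lam P) {p : T → ENNReal}
    (hp : Measurable p) : Measurable fun ω => ∫⁻ s, p s ∂(X ω).toStieltjesFunction.measure :=
  (Measure.measurable_lintegral hp).comp hX.measurable_measure

lemma IsPoissonProcess.lintegral_mul_lintegral_eq_of_Ioc (hX : IsPoissonProcess X lam P)
    {W : Ω → ENNReal} (hW : Measurable W) {ν : Measure T} (hν : ν ≪ intensityMeasure T lam)
    (hfin : ∀ a b, ν (Set.Ioc a b) ≠ ⊤)
    (h : ∀ a b, a ≤ b →
      ∫⁻ ω, W ω * (X ω).toStieltjesFunction.measure (Set.Ioc a b) ∂P = ν (Set.Ioc a b))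
    {p : T → ENNReal} (hp : Measurable p) :
    ∫⁻ ω, W ω * ∫⁻ s, p s ∂(X ω).toStieltjesFunction.measure ∂P = ∫⁻ s, p s ∂ν :=
  lintegral_mul_lintegral_eq_of_Ioc_of_botSet hX.measurable_measure
    (fun _ => StieltjesFunction.measure_botSet _) hW (hν intensityMeasure_botSet) hfin h hp

variable [IsProbabilityMeasure P]

lemma IsPoissonProcess.lintegral_lintegral (hX : IsPoissonProcess X lam P)
    (hlam : IsIntensity T lam) {p : T → ENNReal} (hp : Measurable p) :
    ∫⁻ ω, ∫⁻ s, p s ∂(X ω).toStieltjesFunction.measure ∂P =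
      ∫⁻ s, p s ∂(intensityMeasure T lam) := by
  simpa using hX.lintegral_mul_lintegral_eq_of_Ioc (W := 1) measurable_one
    Measure.AbsolutelyContinuous.rfl hlam.intensityMeasure_Ioc_ne_top
    (fun a b hab => by simpa using hX.lintegral_measure_Ioc hlam hab) hp

lemma IsPoissonProcess.lintegral_measure_Ioc_mul_lintegral (hX : IsPoissonProcess X lam P)
    (hlam : IsIntensity T lam) {c d : T} (hcd : c ≤ d) {p : T → ENNReal} (hp : Measurable p) :
    ∫⁻ ω, (X ω).toStieltjesFunction.measure (Set.Ioc c d) *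
        ∫⁻ s, p s ∂(X ω).toStieltjesFunction.measure ∂P =
      intensityMeasure T lam (Set.Ioc c d) * ∫⁻ s, p s ∂(intensityMeasure T lam) +
        ∫⁻ s in Set.Ioc c d, p s ∂(intensityMeasure T lam) := by
  have hfin := hlam.intensityMeasure_Ioc_ne_top
  have hW : Measurable fun ω => (X ω).toStieltjesFunction.measure (Set.Ioc c d) :=
    (Measure.measurable_coe measurableSet_Ioc).comp hX.measurable_measure
  rw [hX.lintegral_mul_lintegral_eq_of_Ioc hW
    (ν := intensityMeasure T lam (Set.Ioc c d) • intensityMeasure T lam +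
      (intensityMeasure T lam).restrict (Set.Ioc c d)) ?_ (fun a b => ?_) (fun a b hab => ?_) hp]
  · rw [lintegral_add_measure, lintegral_smul_measure, smul_eq_mul]
  · exact (Measure.smul_absolutelyContinuous).add_left
      Measure.restrict_le_self.absolutelyContinuous
  · rw [Measure.add_apply, Measure.smul_apply, smul_eq_mul]
    exact ENNReal.add_ne_top.2 ⟨ENNReal.mul_ne_top (hfin c d) (hfin a b),
      ne_top_of_le_ne_top (hfin a b) (Measure.restrict_apply_le _ _)⟩
  · rw [hX.lintegral_measure_Ioc_mul hlam hcd hab, Measure.add_apply, Measure.smul_apply,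
      smul_eq_mul, Measure.restrict_apply measurableSet_Ioc, Set.inter_comm]

lemma IsPoissonProcess.lintegral_lintegral_mul_lintegral (hX : IsPoissonProcess X lam P)
    (hlam : IsIntensity T lam) {p q : T → ENNReal} (hp : Measurable p) (hq : Measurable q)
    (hpfin : ∫⁻ s, p s ∂(intensityMeasure T lam) ≠ ⊤) :
    ∫⁻ ω, (∫⁻ s, p s ∂(X ω).toStieltjesFunction.measure) *
        ∫⁻ s, q s ∂(X ω).toStieltjesFunction.measure ∂P =
      (∫⁻ s, p s ∂(intensityMeasure T lam)) * ∫⁻ s, q s ∂(intensityMeasure T lam) +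
        ∫⁻ s, p s * q s ∂(intensityMeasure T lam) := by
  rw [hX.lintegral_mul_lintegral_eq_of_Ioc (hX.measurable_lintegral hp)
    (ν := (∫⁻ s, p s ∂(intensityMeasure T lam)) • intensityMeasure T lam +
      (intensityMeasure T lam).withDensity p) ?_ (fun a b => ?_) (fun a b hab => ?_) hq]
  · rw [lintegral_add_measure, lintegral_smul_measure, smul_eq_mul,
      lintegral_withDensity_eq_lintegral_mul _ hp hq]
    rfl
  · exact (Measure.smul_absolutelyContinuous).add_left (withDensity_absolutelyContinuous _ _)
  · rw [Measure.add_apply, Measure.smul_apply, smul_eq_mul, withDensity_apply _ measurableSet_Ioc]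
    exact ENNReal.add_ne_top.2 ⟨ENNReal.mul_ne_top hpfin (hlam.intensityMeasure_Ioc_ne_top a b),
      ne_top_of_le_ne_top hpfin (setLIntegral_le_lintegral _ _)⟩
  · simp_rw [mul_comm (∫⁻ s, p s ∂(X _).toStieltjesFunction.measure)]
    rw [hX.lintegral_measure_Ioc_mul_lintegral hlam hab hp, Measure.add_apply,
      Measure.smul_apply, smul_eq_mul, withDensity_apply _ measurableSet_Ioc, mul_comm]

lemma IsPoissonProcess.ae_lintegral_lt_top (hX : IsPoissonProcess X lam P)
    (hlam : IsIntensity T lam) {p : T → ENNReal} (hp : Measurable p)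
    (hpfin : ∫⁻ s, p s ∂(intensityMeasure T lam) ≠ ⊤) :
    ∀ᵐ ω ∂P, ∫⁻ s, p s ∂(X ω).toStieltjesFunction.measure < ⊤ :=
  ae_lt_top (hX.measurable_lintegral hp) (by rwa [hX.lintegral_lintegral hlam hp])

lemma IsPoissonProcess.ae_integrable {E : Type*} [NormedAddCommGroup E]
    (hX : IsPoissonProcess X lam P) (hlam : IsIntensity T lam) {f : T → E}
    (hf : StronglyMeasurable f) (hfi : Integrable f (intensityMeasure T lam)) :
    ∀ᵐ ω ∂P, Integrable f (X ω).toStieltjesFunction.measure := by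
  filter_upwards [hX.ae_lintegral_lt_top hlam hf.enorm hfi.2.ne] with ω hω
  exact ⟨hf.aestronglyMeasurable, hω⟩

lemma IsPoissonProcess.integrable_toReal_lintegral (hX : IsPoissonProcess X lam P)
    (hlam : IsIntensity T lam) {p : T → ENNReal} (hp : Measurable p)
    (hpfin : ∫⁻ s, p s ∂(intensityMeasure T lam) ≠ ⊤) :
    Integrable (fun ω => (∫⁻ s, p s ∂(X ω).toStieltjesFunction.measure).toReal) P :=
  integrable_toReal_of_lintegral_ne_top (hX.measurable_lintegral hp).aemeasurable
    (by rwa [hX.lintegral_lintegral hlam hp])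

lemma IsPoissonProcess.integral_toReal_lintegral (hX : IsPoissonProcess X lam P)
    (hlam : IsIntensity T lam) {p : T → ENNReal} (hp : Measurable p)
    (hpfin : ∫⁻ s, p s ∂(intensityMeasure T lam) ≠ ⊤) :
    ∫ ω, (∫⁻ s, p s ∂(X ω).toStieltjesFunction.measure).toReal ∂P =
      (∫⁻ s, p s ∂(intensityMeasure T lam)).toReal := by
  rw [integral_toReal (hX.measurable_lintegral hp).aemeasurable
    (hX.ae_lintegral_lt_top hlam hp hpfin), hX.lintegral_lintegral hlam hp]

lemma IsPoissonProcess.memLp_toReal_lintegral (hX : IsPoissonProcess X lam P)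
    (hlam : IsIntensity T lam) {p : T → ENNReal} (hp : Measurable p)
    (hpfin : ∫⁻ s, p s ∂(intensityMeasure T lam) ≠ ⊤)
    (hpp : ∫⁻ s, p s * p s ∂(intensityMeasure T lam) ≠ ⊤) :
    MemLp (fun ω => (∫⁻ s, p s ∂(X ω).toStieltjesFunction.measure).toReal) 2 P := by
  have hmeas := hX.measurable_lintegral hp
  rw [memLp_two_iff_integrable_sq hmeas.ennreal_toReal.aestronglyMeasurable]
  simp_rw [sq, ← ENNReal.toReal_mul]
  refine integrable_toReal_of_lintegral_ne_top (hmeas.mul hmeas).aemeasurable ?_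
  rw [hX.lintegral_lintegral_mul_lintegral hlam hp hp hpfin]
  exact ENNReal.add_ne_top.2 ⟨ENNReal.mul_ne_top hpfin hpfin, hpp⟩

lemma IsPoissonProcess.covariance_toReal_lintegral (hX : IsPoissonProcess X lam P)
    (hlam : IsIntensity T lam) {p q : T → ENNReal} (hp : Measurable p) (hq : Measurable q)
    (hpfin : ∫⁻ s, p s ∂(intensityMeasure T lam) ≠ ⊤)
    (hqfin : ∫⁻ s, q s ∂(intensityMeasure T lam) ≠ ⊤)
    (hpp : ∫⁻ s, p s * p s ∂(intensityMeasure T lam) ≠ ⊤)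
    (hqq : ∫⁻ s, q s * q s ∂(intensityMeasure T lam) ≠ ⊤) :
    cov[fun ω => (∫⁻ s, p s ∂(X ω).toStieltjesFunction.measure).toReal,
      fun ω => (∫⁻ s, q s ∂(X ω).toStieltjesFunction.measure).toReal; P] =
        (∫⁻ s, p s * q s ∂(intensityMeasure T lam)).toReal := by
  have hmeas : Measurable fun ω => (∫⁻ s, p s ∂(X ω).toStieltjesFunction.measure) *
      ∫⁻ s, q s ∂(X ω).toStieltjesFunction.measure :=
    (hX.measurable_lintegral hp).mul (hX.measurable_lintegral hq)
  have hpq : ∫⁻ s, p s * q s ∂(intensityMeasure T lam) ≠ ⊤ := by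
    refine ne_top_of_le_ne_top (ENNReal.add_ne_top.2 ⟨hpp, hqq⟩) ?_
    refine (lintegral_mono fun s => ?_).trans_eq (lintegral_add_left (hp.mul hp) _)
    rcases le_total (p s) (q s) with h | h
    · exact (mul_le_mul_left h _).trans le_add_self
    · exact (mul_le_mul_right h _).trans le_self_add
  have hfin : (∫⁻ s, p s ∂(intensityMeasure T lam)) * ∫⁻ s, q s ∂(intensityMeasure T lam) ≠ ⊤ :=
    ENNReal.mul_ne_top hpfin hqfin
  have hmul := hX.lintegral_lintegral_mul_lintegral hlam hp hq hpfin
  have hmulfin := hmul.trans_ne (ENNReal.add_ne_top.2 ⟨hfin, hpq⟩)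
  rw [covariance_eq_sub (hX.memLp_toReal_lintegral hlam hp hpfin hpp)
    (hX.memLp_toReal_lintegral hlam hq hqfin hqq), hX.integral_toReal_lintegral hlam hp hpfin,
    hX.integral_toReal_lintegral hlam hq hqfin]
  simp only [Pi.mul_apply, ← ENNReal.toReal_mul]
  rw [integral_toReal hmeas.aemeasurable (ae_lt_top hmeas hmulfin), hmul,
    ENNReal.toReal_add hfin hpq, add_sub_cancel_left]

lemma lintegral_ofReal_sq {α : Type*} [MeasurableSpace α] {μ : Measure α} {f : α → ℝ}
    (hf : Measurable f) :
    ∫⁻ s, ENNReal.ofReal (f s ^ 2) ∂μ =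
      ∫⁻ s, ENNReal.ofReal (f s) * ENNReal.ofReal (f s) ∂μ +
        ∫⁻ s, ENNReal.ofReal (-f s) * ENNReal.ofReal (-f s) ∂μ := by
  refine (lintegral_congr fun s => ?_).trans
    (lintegral_add_left (hf.ennreal_ofReal.mul hf.ennreal_ofReal) _)
  rcases le_total 0 (f s) with h | h
  · simp [ENNReal.ofReal_of_nonpos (neg_nonpos.2 h), sq, ENNReal.ofReal_mul h]
  · rw [← neg_sq, sq, ENNReal.ofReal_mul (neg_nonneg.2 h)]
    simp [ENNReal.ofReal_of_nonpos h]

lemma IsPoissonProcess.integral_ae_eq_sub (hX : IsPoissonProcess X lam P)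
    (hlam : IsIntensity T lam) {f : T → ℝ} (hf : Measurable f)
    (hfi : Integrable f (intensityMeasure T lam)) :
    (fun ω => ∫ s, f s ∂(X ω).toStieltjesFunction.measure) =ᵐ[P]
      (fun ω => (∫⁻ s, ENNReal.ofReal (f s) ∂(X ω).toStieltjesFunction.measure).toReal) -
        fun ω => (∫⁻ s, ENNReal.ofReal (-f s) ∂(X ω).toStieltjesFunction.measure).toReal := by
  filter_upwards [hX.ae_integrable hlam hf.stronglyMeasurable hfi] with ω hω
  exact integral_eq_lintegral_pos_part_sub_lintegral_neg_part hω

lemma IsPoissonProcess.integrable_integral_measure (hX : IsPoissonProcess X lam P)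
    (hlam : IsIntensity T lam) {f : T → ℝ} (hf : Measurable f)
    (hfi : Integrable f (intensityMeasure T lam)) :
    Integrable (fun ω => ∫ s, f s ∂(X ω).toStieltjesFunction.measure) P :=
  (integrable_congr (hX.integral_ae_eq_sub hlam hf hfi)).2
    ((hX.integrable_toReal_lintegral hlam hf.ennreal_ofReal hfi.lintegral_lt_top.ne).sub
      (hX.integrable_toReal_lintegral hlam hf.neg.ennreal_ofReal hfi.neg.lintegral_lt_top.ne))

lemma IsPoissonProcess.integral_integral_measure (hX : IsPoissonProcess X lam P)
    (hlam : IsIntensity T lam) {f : T → ℝ} (hf : Measurable f)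
    (hfi : Integrable f (intensityMeasure T lam)) :
    ∫ ω, ∫ s, f s ∂(X ω).toStieltjesFunction.measure ∂P =
      ∫ s, f s ∂(intensityMeasure T lam) := by
  have hp : Measurable fun s => ENNReal.ofReal (f s) := hf.ennreal_ofReal
  have hq : Measurable fun s => ENNReal.ofReal (-f s) := hf.neg.ennreal_ofReal
  have hpfin : ∫⁻ s, ENNReal.ofReal (f s) ∂(intensityMeasure T lam) ≠ ⊤ :=
    hfi.lintegral_lt_top.ne
  have hqfin : ∫⁻ s, ENNReal.ofReal (-f s) ∂(intensityMeasure T lam) ≠ ⊤ :=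
    hfi.neg.lintegral_lt_top.ne
  rw [integral_congr_ae (hX.integral_ae_eq_sub hlam hf hfi),
    integral_sub' (hX.integrable_toReal_lintegral hlam hp hpfin)
      (hX.integrable_toReal_lintegral hlam hq hqfin),
    hX.integral_toReal_lintegral hlam hp hpfin, hX.integral_toReal_lintegral hlam hq hqfin,
    integral_eq_lintegral_pos_part_sub_lintegral_neg_part hfi]

variable {f : T → ℝ} (hX : IsPoissonProcess X lam P) (hlam : IsIntensity T lam)
  (hf : Measurable f) (hfi : Integrable f (intensityMeasure T lam))
  (hf2 : MemLp f 2 (intensityMeasure T lam))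
include hX hlam hf hfi hf2

lemma IsPoissonProcess.memLp_toReal_lintegral_ofReal :
    MemLp (fun ω => (∫⁻ s, ENNReal.ofReal (f s) ∂(X ω).toStieltjesFunction.measure).toReal)
      2 P := by
  refine hX.memLp_toReal_lintegral hlam hf.ennreal_ofReal hfi.lintegral_lt_top.ne ?_
  have h := hf2.integrable_sq.lintegral_lt_top.ne
  rw [lintegral_ofReal_sq hf] at h
  exact (ENNReal.add_ne_top.1 h).1

lemma IsPoissonProcess.memLp_integral_measure :
    MemLp (fun ω => ∫ s, f s ∂(X ω).toStieltjesFunction.measure) 2 P :=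
  (memLp_congr_ae (hX.integral_ae_eq_sub hlam hf hfi)).2
    ((hX.memLp_toReal_lintegral_ofReal hlam hf hfi hf2).sub
      (hX.memLp_toReal_lintegral_ofReal hlam hf.neg hfi.neg hf2.neg))

lemma IsPoissonProcess.variance_integral_measure :
    Var[fun ω => ∫ s, f s ∂(X ω).toStieltjesFunction.measure; P] =
      ∫ s, f s ^ 2 ∂(intensityMeasure T lam) := by
  have hp : Measurable fun s => ENNReal.ofReal (f s) := hf.ennreal_ofReal
  have hq : Measurable fun s => ENNReal.ofReal (-f s) := hf.neg.ennreal_ofReal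
  have hpfin : ∫⁻ s, ENNReal.ofReal (f s) ∂(intensityMeasure T lam) ≠ ⊤ :=
    hfi.lintegral_lt_top.ne
  have hqfin : ∫⁻ s, ENNReal.ofReal (-f s) ∂(intensityMeasure T lam) ≠ ⊤ :=
    hfi.neg.lintegral_lt_top.ne
  have hsq := hf2.integrable_sq.lintegral_lt_top.ne
  rw [lintegral_ofReal_sq hf] at hsq
  obtain ⟨hpp, hqq⟩ := ENNReal.add_ne_top.1 hsq
  have hpL := hX.memLp_toReal_lintegral hlam hp hpfin hpp
  have hqL := hX.memLp_toReal_lintegral hlam hq hqfin hqq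
  have hpq (s : T) : ENNReal.ofReal (f s) * ENNReal.ofReal (-f s) = 0 := by
    rcases le_total 0 (f s) with h | h <;> simp [h]
  rw [variance_congr (hX.integral_ae_eq_sub hlam hf hfi), variance_sub hpL hqL,
    ← covariance_self hpL.aestronglyMeasurable.aemeasurable,
    ← covariance_self hqL.aestronglyMeasurable.aemeasurable,
    hX.covariance_toReal_lintegral hlam hp hp hpfin hpfin hpp hpp,
    hX.covariance_toReal_lintegral hlam hq hq hqfin hqfin hqq hqq,
    hX.covariance_toReal_lintegral hlam hp hq hpfin hqfin hpp hqq,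
    integral_eq_lintegral_of_nonneg_ae (ae_of_all _ fun s => sq_nonneg (f s))
      hf2.integrable_sq.aestronglyMeasurable, lintegral_ofReal_sq hf, ENNReal.toReal_add hpp hqq]
  simp [hpq]

end Campbell

section CentralLimitTheorem

variable {Ω E : Type*} [MeasurableSpace Ω] {P : Measure Ω}
  [NormedAddCommGroup E] [InnerProductSpace ℝ E] [MeasurableSpace E] [BorelSpace E]

lemma charFun_map_eq_charFun_map_inner [SecondCountableTopology E] {V : Ω → E}
    (hV : AEMeasurable V P) (u : E) :
    charFun (P.map V) u = charFun (P.map fun ω => inner ℝ u (V ω)) 1 := by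
  rw [charFun_apply, charFun_apply, integral_map hV (by fun_prop),
    integral_map (by fun_prop) (by fun_prop)]
  simp [real_inner_comm]

theorem tendstoInDistribution_inv_sqrt_smul_sum_sub [IsProbabilityMeasure P]
    [FiniteDimensional ℝ E] {Z : ℕ → Ω → E}
    {μ : Measure E} [IsGaussian μ] (hμ : μ[id] = 0)
    (hcov : ∀ u, covarianceBilin μ u u = Var[fun ω => inner ℝ u (Z 0 ω); P])
    (hZ : MemLp (Z 0) 2 P) (hindep : iIndepFun Z P)
    (hident : ∀ i, IdentDistrib (Z i) (Z 0) P P) :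
    TendstoInDistribution
      (fun (n : ℕ) ω => (√(n : ℝ))⁻¹ • (∑ j ∈ Finset.range n, Z j ω - (n : ℝ) • P[Z 0]))
      atTop id (fun _ => P) μ := by
  have := FiniteDimensional.proper_real E
  have hmeas (n : ℕ) : AEMeasurable
      (fun ω => (√(n : ℝ))⁻¹ • (∑ j ∈ Finset.range n, Z j ω - (n : ℝ) • P[Z 0])) P := by
    have hsum : AEMeasurable (fun ω => ∑ j ∈ Finset.range n, Z j ω) P :=
      Finset.aemeasurable_fun_sum _ fun j _ => (hident j).aemeasurable_fst
    fun_prop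
  refine ⟨hmeas, aemeasurable_id, ProbabilityMeasure.tendsto_iff_tendsto_charFun.2 fun u => ?_⟩
  have hu : Measurable fun x : E => inner ℝ u x := by fun_prop
  have hclt := tendstoInDistribution_inv_sqrt_mul_sum_sub (P := P)
    (X := fun j ω => inner ℝ u (Z j ω)) (Y := id)
    (P' := gaussianReal 0 Var[fun ω => inner ℝ u (Z 0 ω); P].toNNReal) HasLaw.id
    (hZ.const_inner u) (hindep.comp (fun _ x => inner ℝ u x) fun _ => hu)
    fun i => (hident i).comp hu
  have hlim := ProbabilityMeasure.tendsto_iff_tendsto_charFun.1 hclt.tendsto 1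
  simp only [ProbabilityMeasure.coe_mk, Measure.map_id] at hlim ⊢
  have hmean : ∫ ω, inner ℝ u (Z 0 ω) ∂P = inner ℝ u (P[Z 0]) :=
    integral_inner (hZ.integrable one_le_two) u
  convert! hlim using 2 with n
  · rw [charFun_map_eq_charFun_map_inner (hmeas n)]
    simp only [inner_smul_right, inner_sub_right, inner_sum, hmean]
  · rw [IsGaussian.charFun_eq', hμ, hcov, charFun_gaussianReal,
      Real.coe_toNNReal _ (variance_nonneg _ _)]
    simp

lemma sqrt_smul_inv_smul_sub {V : Type*} [AddCommGroup V] [Module ℝ V] (n : ℕ) (x m : V) :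
    √(n : ℝ) • ((n : ℝ)⁻¹ • x - m) = (√(n : ℝ))⁻¹ • (x - (n : ℝ) • m) := by
  rcases Nat.eq_zero_or_pos n with rfl | hn
  · simp
  · have hn' : (n : ℝ) ≠ 0 := by positivity
    have hsqrt : √(n : ℝ) = (√(n : ℝ))⁻¹ * n := by
      rw [eq_inv_mul_iff_mul_eq₀ (by positivity), Real.mul_self_sqrt n.cast_nonneg]
    rw [hsqrt, mul_smul, smul_sub, smul_inv_smul₀ hn', ← hsqrt]

end CentralLimitTheorem

section DeltaMethod

variable {ι Ω Ω' : Type*} [MeasurableSpace Ω] [MeasurableSpace Ω'] {P : Measure Ω}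
  {P' : Measure Ω'} {l : Filter ι}

lemma tendstoInMeasure_comp_of_continuousAt {E F : Type*} [PseudoMetricSpace E]
    [PseudoMetricSpace F] {a : ι → Ω → E} {m : E} {f : E → F} (hf : ContinuousAt f m)
    (ha : TendstoInMeasure P a l fun _ => m) :
    TendstoInMeasure P (fun i ω => f (a i ω)) l fun _ => f m := by
  rw [tendstoInMeasure_iff_dist] at ha ⊢
  intro ε hε
  obtain ⟨δ, hδ, hfδ⟩ := Metric.continuousAt_iff.1 hf ε hε
  refine tendsto_of_tendsto_of_tendsto_of_le_of_le tendsto_const_nhds (ha δ hδ)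
    (fun _ => zero_le) fun i => measure_mono fun ω hω => ?_
  by_contra h
  exact (hfδ (not_le.1 h)).not_ge hω

theorem tendstoInDistribution_smul_sub_of_hasFDerivAt {E F : Type*} [IsProbabilityMeasure P]
    [IsProbabilityMeasure P'] [NormedAddCommGroup E] [NormedSpace ℝ E] [MeasurableSpace E]
    [BorelSpace E] [SecondCountableTopology E] [NormedAddCommGroup F] [NormedSpace ℝ F]
    [MeasurableSpace F] [BorelSpace F] [SecondCountableTopology F] [l.IsCountablyGenerated]
    {r : ι → ℝ} {a : ι → Ω → E} {m : E} {H : E → F} {L : E →L[ℝ] F} {Z : Ω' → E}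
    (hr : ∀ i, 0 ≤ r i) (hH : Measurable H) (hL : HasFDerivAt H L m)
    (ha : ∀ i, AEMeasurable (a i) P) (ham : TendstoInMeasure P a l fun _ => m)
    (hZ : TendstoInDistribution (fun i ω => r i • (a i ω - m)) l Z (fun _ => P) P') :
    TendstoInDistribution (fun i ω => r i • (H (a i ω) - H m)) l (fun ω => L (Z ω))
      (fun _ => P) P' := by
  let e : E → F := fun x => ‖x - m‖⁻¹ • (H x - H m - L (x - m))
  have hem : e m = 0 := by simp [e]
  have he : Measurable e := by fun_prop
  have he_cont : ContinuousAt e m := by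
    rw [ContinuousAt, hem, tendsto_zero_iff_norm_tendsto_zero]
    simpa [e, norm_smul] using hasFDerivAt_iff_tendsto.1 hL
  have hH_eq (x : E) : H x - H m = L (x - m) + ‖x - m‖ • e x := by
    rcases eq_or_ne x m with rfl | hne
    · simp
    · simp [e, smul_inv_smul₀ (norm_ne_zero_iff.2 (sub_ne_zero.2 hne))]
  have h := hZ.continuous_comp_prodMk_of_tendstoInMeasure_const
    (g := fun y : E × F => L y.1 + ‖y.1‖ • y.2) (by fun_prop)
    (tendstoInMeasure_comp_of_continuousAt he_cont ham) fun i => he.comp_aemeasurable (ha i)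
  convert! h using 1
  · ext i ω
    rw [hH_eq, map_smul, norm_smul, Real.norm_of_nonneg (hr i), smul_add, smul_smul]
  · simp only [hem, smul_zero, add_zero]

end DeltaMethod

section Gaussian

variable {ι κ : Type*} [Fintype ι] [DecidableEq ι] [Fintype κ] [DecidableEq κ]

lemma multivariateGaussian_map_toLpLin {S : Matrix ι ι ℝ} (hS : S.PosSemidef)
    (m : EuclideanSpace ℝ ι) (J : Matrix κ ι ℝ) :
    (multivariateGaussian m S).map (Matrix.toLpLin 2 2 J) =
      multivariateGaussian (Matrix.toLpLin 2 2 J m) (J * S * J.transpose) := by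
  have hJ_meas : Measurable (Matrix.toLpLin 2 2 J) :=
    (LinearMap.continuous_of_finiteDimensional _).measurable
  have hJS : (J * S * J.transpose).PosSemidef := by
    simpa using hS.mul_mul_conjTranspose_same J
  have : IsProbabilityMeasure ((multivariateGaussian m S).map (Matrix.toLpLin 2 2 J)) :=
    Measure.isProbabilityMeasure_map hJ_meas.aemeasurable
  refine Measure.ext_of_charFun (funext fun t => ?_)
  have hinner (x : EuclideanSpace ℝ ι) :
      inner ℝ (Matrix.toLpLin 2 2 J x) t = inner ℝ x (Matrix.toLpLin 2 2 J.transpose t) := by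
    simp only [EuclideanSpace.inner_eq_star_dotProduct, star_trivial, Matrix.toLpLin_apply]
    rw [Matrix.mulVec_transpose, ← Matrix.dotProduct_mulVec]
  have hcov : (Matrix.toLpLin 2 2 J.transpose t).ofLp ⬝ᵥ
        S.mulVec (Matrix.toLpLin 2 2 J.transpose t).ofLp =
      t.ofLp ⬝ᵥ (J * S * J.transpose).mulVec t.ofLp := by
    simp only [Matrix.toLpLin_apply, ← Matrix.mulVec_mulVec]
    rw [Matrix.mulVec_transpose, Matrix.dotProduct_mulVec t.ofLp J]
  rw [charFun_apply, integral_map hJ_meas.aemeasurable (by fun_prop)]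
  simp_rw [hinner]
  rw [← charFun_apply, charFun_multivariateGaussian hS, charFun_multivariateGaussian hJS, hcov,
    real_inner_comm, ← hinner, real_inner_comm]

end Gaussian

section MethodOfMoments

variable {d : ℕ} {T : Set ℝ} {lam : EuclideanSpace ℝ (Fin d) → ℝ → ℝ}
  {g : ℝ → EuclideanSpace ℝ (Fin d)} {θ : EuclideanSpace ℝ (Fin d)}

lemma smul_inner_sq_eq_sum {ι : Type*} [Fintype ι] (u x : EuclideanSpace ℝ ι) (c : ℝ) :
    c • inner ℝ u x ^ 2 = ∑ l, ∑ k, u l * u k * (x l * x k * c) := by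
  have hinner : inner ℝ u x = ∑ i, u i * x i := by simp [PiLp.inner_apply, mul_comm]
  simp_rw [hinner, sq, Finset.sum_mul_sum, Finset.smul_sum, smul_eq_mul]
  exact Finset.sum_congr rfl fun l _ => Finset.sum_congr rfl fun k _ => by ring

lemma integrableOn_smul_inner_sq
    (hG : ∀ l k, IntegrableOn (fun s => g s l * g s k * lam θ s) T)
    (u : EuclideanSpace ℝ (Fin d)) : IntegrableOn (fun s => lam θ s • inner ℝ u (g s) ^ 2) T := by
  simp_rw [smul_inner_sq_eq_sum]
  exact integrable_finsetSum _ fun l _ => integrable_finsetSum _ fun k _ => (hG l k).const_mul _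

lemma dotProduct_momentCov_mulVec
    (hG : ∀ l k, IntegrableOn (fun s => g s l * g s k * lam θ s) T)
    (u : EuclideanSpace ℝ (Fin d)) :
    u.ofLp ⬝ᵥ (momentCov T lam g θ).mulVec u.ofLp = ∫ s in T, lam θ s • inner ℝ u (g s) ^ 2 := by
  have hterm (l k : Fin d) :
      IntegrableOn (fun s => u l * u k * (g s l * g s k * lam θ s)) T := (hG l k).const_mul _
  simp_rw [smul_inner_sq_eq_sum]
  rw [integral_finsetSum _ fun l _ => integrable_finsetSum _ fun k _ => hterm l k]
  simp only [dotProduct, Matrix.mulVec, Finset.mul_sum]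
  refine Finset.sum_congr rfl fun l _ => ?_
  rw [integral_finsetSum _ fun k _ => hterm l k]
  refine Finset.sum_congr rfl fun k _ => ?_
  rw [integral_const_mul, momentCov, Matrix.of_apply]
  ring

lemma posSemidef_momentCov [T.OrdConnected] (hlam : IsIntensity T (lam θ))
    (hG : ∀ l k, IntegrableOn (fun s => g s l * g s k * lam θ s) T) :
    (momentCov T lam g θ).PosSemidef := by
  refine Matrix.PosSemidef.of_dotProduct_mulVec_nonneg ?_ fun x => ?_
  · ext l k
    simp [momentCov, mul_comm (g _ l)]
  · rw [star_trivial, dotProduct_momentCov_mulVec hG (WithLp.toLp 2 x)]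
    exact setIntegral_nonneg ‹T.OrdConnected›.measurableSet fun s hs =>
      mul_nonneg (hlam.nonneg s hs) (sq_nonneg _)

lemma fderiv_eq_toLpLin_jacobian (H : EuclideanSpace ℝ (Fin d) → EuclideanSpace ℝ (Fin d))
    (a : EuclideanSpace ℝ (Fin d)) : ⇑(fderiv ℝ H a) = Matrix.toLpLin 2 2 (jacobian H a) := by
  ext x l
  have hx : x = ∑ k, x k • EuclideanSpace.single k (1 : ℝ) := by
    ext i
    simp [Pi.single_apply]
  conv_lhs => rw [hx]
  simp [jacobian, Matrix.mulVec, dotProduct, mul_comm]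

variable [T.OrdConnected]

lemma IsIntensity.memLp_inner (hlam : IsIntensity T (lam θ)) (hg : Measurable g)
    (hG : ∀ l k, IntegrableOn (fun s => g s l * g s k * lam θ s) T)
    (u : EuclideanSpace ℝ (Fin d)) :
    MemLp (fun s : T => inner ℝ u (g s)) 2 (intensityMeasure T (lam θ)) :=
  (memLp_two_iff_integrable_sq
    (hg.comp measurable_subtype_coe).const_inner.aestronglyMeasurable).2
    ((hlam.integrable_intensityMeasure_iff fun s => inner ℝ u (g s) ^ 2).2
      (integrableOn_smul_inner_sq hG u))

variable {Ω : Type*} [MeasurableSpace Ω] {P : Measure Ω}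

lemma measurable_empiricalMoment {X : ℕ → Ω → CountingPath T}
    (hX : ∀ j, IsPoissonProcess (X j) (lam θ) P) (hg : Measurable g)
    (n : ℕ) : Measurable (empiricalMoment X g n) := by
  have hint (j : ℕ) : Measurable fun ω => (X j ω).integral g :=
    (CountingPath.stronglyMeasurable_integral
      (fun s t => ((hX j).measurable t).sub ((hX j).measurable s)) hg.stronglyMeasurable).measurable
  unfold empiricalMoment
  fun_prop

variable [IsProbabilityMeasure P]

section PathIntegralMoments

variable {X : Ω → CountingPath T}

lemma IsPoissonProcess.inner_integral_ae_eq (hX : IsPoissonProcess X (lam θ) P)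
    (hlam : IsIntensity T (lam θ)) (hg : Measurable g)
    (hM : IntegrableOn (fun s => lam θ s • g s) T) (u : EuclideanSpace ℝ (Fin d)) :
    (fun ω => inner ℝ u ((X ω).integral g)) =ᵐ[P]
      fun ω => ∫ s : T, inner ℝ u (g s) ∂(X ω).toStieltjesFunction.measure := by
  filter_upwards [hX.ae_integrable hlam (hg.comp measurable_subtype_coe).stronglyMeasurable
    ((hlam.integrable_intensityMeasure_iff g).2 hM)] with ω hω
  exact (integral_inner hω u).symm

lemma IsPoissonProcess.integrable_integral (hX : IsPoissonProcess X (lam θ) P)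
    (hlam : IsIntensity T (lam θ)) (hg : Measurable g)
    (hM : IntegrableOn (fun s => lam θ s • g s) T) :
    Integrable (fun ω => (X ω).integral g) P := by
  refine Integrable.of_eval_piLp fun i => ?_
  have hi := (integrable_congr (hX.inner_integral_ae_eq hlam hg hM (EuclideanSpace.single i 1))).2
    (hX.integrable_integral_measure hlam (by fun_prop)
      (((hlam.integrable_intensityMeasure_iff g).2 hM).const_inner _))
  simpa [EuclideanSpace.inner_single_left] using hi

lemma IsPoissonProcess.integral_integral_eq_momentMap (hX : IsPoissonProcess X (lam θ) P)
    (hlam : IsIntensity T (lam θ)) (hg : Measurable g)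
    (hM : IntegrableOn (fun s => lam θ s • g s) T) :
    ∫ ω, (X ω).integral g ∂P = momentMap T lam g θ := by
  have hgT : Integrable (fun s : T => g s) (intensityMeasure T (lam θ)) :=
    (hlam.integrable_intensityMeasure_iff g).2 hM
  refine ext_inner_left ℝ fun u => ?_
  rw [← integral_inner (hX.integrable_integral hlam hg hM),
    integral_congr_ae (hX.inner_integral_ae_eq hlam hg hM u),
    hX.integral_integral_measure hlam (by fun_prop) (hgT.const_inner u),
    integral_inner hgT, hlam.integral_intensityMeasure g, momentMap]

lemma IsPoissonProcess.memLp_integral (hX : IsPoissonProcess X (lam θ) P)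
    (hlam : IsIntensity T (lam θ)) (hg : Measurable g)
    (hM : IntegrableOn (fun s => lam θ s • g s) T)
    (hG : ∀ l k, IntegrableOn (fun s => g s l * g s k * lam θ s) T) :
    MemLp (fun ω => (X ω).integral g) 2 P := by
  refine MemLp.of_eval_piLp fun i => ?_
  have hi := (memLp_congr_ae (hX.inner_integral_ae_eq hlam hg hM (EuclideanSpace.single i 1))).2
    (hX.memLp_integral_measure hlam (by fun_prop)
      (((hlam.integrable_intensityMeasure_iff g).2 hM).const_inner _) (hlam.memLp_inner hg hG _))
  simpa [EuclideanSpace.inner_single_left] using hi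

lemma IsPoissonProcess.variance_inner_integral (hX : IsPoissonProcess X (lam θ) P)
    (hlam : IsIntensity T (lam θ)) (hg : Measurable g)
    (hM : IntegrableOn (fun s => lam θ s • g s) T)
    (hG : ∀ l k, IntegrableOn (fun s => g s l * g s k * lam θ s) T)
    (u : EuclideanSpace ℝ (Fin d)) :
    Var[fun ω => inner ℝ u ((X ω).integral g); P] =
      u.ofLp ⬝ᵥ (momentCov T lam g θ).mulVec u.ofLp := by
  rw [variance_congr (hX.inner_integral_ae_eq hlam hg hM u),
    hX.variance_integral_measure hlam (by fun_prop)
      (((hlam.integrable_intensityMeasure_iff g).2 hM).const_inner u) (hlam.memLp_inner hg hG u),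
    dotProduct_momentCov_mulVec hG,
    hlam.integral_intensityMeasure fun s => inner ℝ u (g s) ^ 2]

end PathIntegralMoments

section Asymptotics

variable {X : ℕ → Ω → CountingPath T}

theorem tendstoInMeasure_empiricalMoment (hlam : IsIntensity T (lam θ)) (hg : Measurable g)
    (hM : IntegrableOn (fun s => lam θ s • g s) T)
    (hX : ∀ j, IsPoissonProcess (X j) (lam θ) P)
    (hindep : iIndepFun (fun j ω (t : T) => (X j ω).toFun t) P) :
    TendstoInMeasure P (empiricalMoment X g) atTop fun _ => momentMap T lam g θ := by
  refine tendstoInMeasure_of_tendsto_ae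
    (fun n => (measurable_empiricalMoment hX hg n).aestronglyMeasurable) ?_
  rw [← (hX 0).integral_integral_eq_momentMap hlam hg hM]
  exact strong_law_ae (fun j ω => (X j ω).integral g) ((hX 0).integrable_integral hlam hg hM)
    (fun i j hij => (iIndepFun_countingPath_integral hg.stronglyMeasurable hindep).indepFun hij)
    fun i => (hX i).identDistrib_integral (hX 0) hg.stronglyMeasurable

theorem tendstoInDistribution_sqrt_smul_empiricalMoment_sub (hlam : IsIntensity T (lam θ))
    (hg : Measurable g) (hM : IntegrableOn (fun s => lam θ s • g s) T)
    (hG : ∀ l k, IntegrableOn (fun s => g s l * g s k * lam θ s) T)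
    (hX : ∀ j, IsPoissonProcess (X j) (lam θ) P)
    (hindep : iIndepFun (fun j ω (t : T) => (X j ω).toFun t) P) :
    TendstoInDistribution
      (fun (n : ℕ) ω => √(n : ℝ) • (empiricalMoment X g n ω - momentMap T lam g θ))
      atTop id (fun _ => P) (multivariateGaussian 0 (momentCov T lam g θ)) := by
  have hcov (u : EuclideanSpace ℝ (Fin d)) :
      covarianceBilin (multivariateGaussian 0 (momentCov T lam g θ)) u u =
        Var[fun ω => inner ℝ u ((X 0 ω).integral g); P] := by
    rw [covarianceBilin_multivariateGaussian (posSemidef_momentCov hlam hG),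
      (hX 0).variance_inner_integral hlam hg hM hG]
  have hclt := tendstoInDistribution_inv_sqrt_smul_sum_sub
    (Z := fun j ω => (X j ω).integral g) integral_id_multivariateGaussian' hcov
    ((hX 0).memLp_integral hlam hg hM hG)
    (iIndepFun_countingPath_integral hg.stronglyMeasurable hindep)
    fun i => (hX i).identDistrib_integral (hX 0) hg.stronglyMeasurable
  simpa only [empiricalMoment, sqrt_smul_inv_smul_sub,
    (hX 0).integral_integral_eq_momentMap hlam hg hM] using hclt

end Asymptotics

end MethodOfMoments

theorem theorem1_general {d : ℕ} (T : Set ℝ) [T.OrdConnected]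
    (lam : EuclideanSpace ℝ (Fin d) → ℝ → ℝ) (g : ℝ → EuclideanSpace ℝ (Fin d))
    (hg : Measurable g) (θ₀ : EuclideanSpace ℝ (Fin d)) (hlam : IsIntensity T (lam θ₀))
    (hM : IntegrableOn (fun s => lam θ₀ s • g s) T)
    (hG : ∀ l k, IntegrableOn (fun s => g s l * g s k * lam θ₀ s) T)
    (H : EuclideanSpace ℝ (Fin d) → EuclideanSpace ℝ (Fin d)) (hH : Measurable H)
    (hHM : H (momentMap T lam g θ₀) = θ₀)
    (hH' : DifferentiableAt ℝ H (momentMap T lam g θ₀))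
    {Ω : Type*} [MeasurableSpace Ω] (P : Measure Ω) [IsProbabilityMeasure P]
    (X : ℕ → Ω → CountingPath T) (hX : ∀ j, IsPoissonProcess (X j) (lam θ₀) P)
    (hindep : iIndepFun (fun j ω (t : T) => (X j ω).toFun t) P) :
    TendstoInMeasure P (momentEstimator X g H) atTop (fun _ => θ₀) ∧
    TendstoInDistribution (fun (n : ℕ) ω => √(n : ℝ) • (momentEstimator X g H n ω - θ₀))
      atTop id (fun _ => P) (multivariateGaussian 0 (limitCov T lam g H θ₀)) := by
  have hlln := tendstoInMeasure_empiricalMoment hlam hg hM hX hindep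
  have hclt := tendstoInDistribution_sqrt_smul_empiricalMoment_sub hlam hg hM hG hX hindep
  have hcons := tendstoInMeasure_comp_of_continuousAt hH'.continuousAt hlln
  have hdelta := tendstoInDistribution_smul_sub_of_hasFDerivAt
    (fun n : ℕ => Real.sqrt_nonneg n) hH hH'.hasFDerivAt
    (fun n => (measurable_empiricalMoment hX hg n).aemeasurable) hlln hclt
  have hgauss : (multivariateGaussian 0 (momentCov T lam g θ₀)).map
      (fderiv ℝ H (momentMap T lam g θ₀)) = multivariateGaussian 0 (limitCov T lam g H θ₀) := by
    rw [fderiv_eq_toLpLin_jacobian, multivariateGaussian_map_toLpLin (posSemidef_momentCov hlam hG),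
      map_zero, limitCov]
  rw [hHM] at hcons hdelta
  refine ⟨hcons, hdelta.forall_aemeasurable, aemeasurable_id, ?_⟩
  convert! hdelta.tendsto using 2
  exact congrArg 𝓝 (Subtype.ext (Measure.map_id.trans hgauss.symm))

theorem theorem1 {d : ℕ} (T : Set ℝ) [T.OrdConnected]
    (Θ : Set (EuclideanSpace ℝ (Fin d)))
    (hΘ_open : IsOpen Θ) (hΘ_convex : Convex ℝ Θ) (hΘ_bdd : Bornology.IsBounded Θ)
    (lam : EuclideanSpace ℝ (Fin d) → ℝ → ℝ) (hlam : ∀ θ ∈ Θ, IsIntensity T (lam θ))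
    (g : ℝ → EuclideanSpace ℝ (Fin d)) (hg : Measurable g)
    -- the integrals that define `M` on `Θ` and `G` at the true value are finite
    (hM : ∀ θ ∈ Θ, IntegrableOn (fun s => lam θ s • g s) T)
    (θ₀ : EuclideanSpace ℝ (Fin d)) (hθ₀ : θ₀ ∈ Θ)
    (hG : ∀ l k, IntegrableOn (fun s => g s l * g s k * lam θ₀ s) T)
    (H : EuclideanSpace ℝ (Fin d) → EuclideanSpace ℝ (Fin d)) (hH : Measurable H)
    (hreg : RegularityConditions Θ (momentMap T lam g) H)
    {Ω : Type*} [MeasurableSpace Ω] (P : Measure Ω) [IsProbabilityMeasure P]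
    -- independent Poisson processes with the same intensity `λ(θ₀, ·)`
    (X : ℕ → Ω → CountingPath T)
    (hX : ∀ j, IsPoissonProcess (X j) (lam θ₀) P)
    (hindep : iIndepFun (fun j ω (t : T) => (X j ω).toFun t) P) :
    TendstoInMeasure P (momentEstimator X g H) atTop (fun _ => θ₀) ∧
    TendstoInDistribution (fun (n : ℕ) ω => √(n : ℝ) • (momentEstimator X g H n ω - θ₀))
      atTop id (fun _ => P) (multivariateGaussian 0 (limitCov T lam g H θ₀)) := by
  obtain ⟨U, hU, hMU, hHU⟩ := hreg.contDiffOn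
  exact theorem1_general T lam g hg θ₀ (hlam θ₀ hθ₀) (hM θ₀ hθ₀) hG H hH (hreg.leftInvOn hθ₀)
    ((hHU.differentiableOn one_ne_zero).differentiableAt
      (hU.mem_nhds (hMU (Set.mem_image_of_mem _ hθ₀)))) P X hX hindep
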